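/- Let $p\ge 5$, $2\le r\le p-3$, $k\ge 0$, and let $0<\tau_1<\dots<\tau_k<1$. Let $\mathcal S$ be the space of univariate splines on $[0,1]$ of degree $p$ with inner knots $\tau_1,\dots,\tau_k$, each of multiplicity $p-r$ (that is, functions which are a polynomial of degree at most $p$ on each knot span and are $C^r$ on $[0,1]$), and let $\mathcal S_2=\mathcal S\otimes\mathcal S$ be the tensor-product spline space on $[0,1]^2$. Let $\mathbf F^{(L)},\mathbf F^{(R)}\in\mathcal S_2\times\mathcal S_2$ be two injective mappings $[0,1]^2\to\mathbb R^2$ whose Jacobian determinant vanishes nowhere on $[0,1]^2$. Put $\Omega^{(S)}=\mathbf F^{(S)}([0,1]^2)$ for $S\in\{L,R\}$ and $\Omega=\Omega^{(L)}\cup\Omega^{(R)}$, and assume that $\mathbf F_0(v):=\mathbf F^{(L)}(0,v)=\mathbf F^{(R)}(0,v)$ for all $v\in[0,1]$ and that $\Omega^{(L)}\cap\Omega^{(R)}=\mathbf F_0([0,1])$. All derivatives are one-sided at the boundary of $[0,1]$ and $[0,1]^2$. Assume that this two-patch parameterization is bilinear-like $G^2$ with polynomials $\alpha^{(L)},\alpha^{(R)},\beta^{(L)},\beta^{(R)}$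 of degree at most $1$, which means that, with $$\beta=\alpha^{(L)}\beta^{(R)}-\alpha^{(R)}\beta^{(L)},\qquad \eta=2(\alpha^{(L)})'\alpha^{(R)}\beta,\qquad \theta=2\bigl(\alpha^{(L)}(\beta^{(L)})'-(\alpha^{(L)})'\beta^{(L)}\bigr)\alpha^{(R)}\beta,$$ $$\mathbf Z(v)=(\alpha^{(L)}(v))^2D_{uu}\mathbf F^{(R)}(0,v)-\Bigl((\alpha^{(R)}(v))^2D_{uu}\mathbf F^{(L)}(0,v)+2\alpha^{(R)}(v)\beta(v)D_{uv}\mathbf F^{(L)}(0,v)+\beta(v)^2\mathbf F_0''(v)\Bigr),$$ one has for all $v\in[0,1]$: $\alpha^{(L)}(v)\alpha^{(R)}(v)<0$, $$\alpha^{(R)}(v)D_u\mathbf F^{(L)}(0,v)-\alpha^{(L)}(v)D_u\mathbf F^{(R)}(0,v)+\beta(v)D_v\mathbf F^{(L)}(0,v)=\mathbf 0,$$ $$\alpha^{(L)}(v)\mathbf Z(v)+\eta(v)D_u\mathbf F^{(L)}(0,v)+\theta(v)D_v\mathbf F^{(L)}(0,v)=\mathbf 0.$$ Let $\phi:\Omega\to\mathbb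 R$ be an isogeometric function, i.e. $g^{(S)}:=\phi\circ\mathbf F^{(S)}\in\mathcal S_2$ for $S\in\{L,R\}$. Then $\phi\in C^2(\Omega)$ if and only if for all $v\in[0,1]$ $$g^{(L)}(0,v)=g^{(R)}(0,v),$$ $$\frac{D_ug^{(L)}(0,v)-\beta^{(L)}(v)g_0'(v)}{\alpha^{(L)}(v)}=\frac{D_ug^{(R)}(0,v)-\beta^{(R)}(v)g_0'(v)}{\alpha^{(R)}(v)},$$ $$\frac{D_{uu}g^{(L)}(0,v)-(\beta^{(L)}(v))^2g_0''(v)-2\alpha^{(L)}(v)\beta^{(L)}(v)g_1'(v)}{(\alpha^{(L)}(v))^2}=\frac{D_{uu}g^{(R)}(0,v)-(\beta^{(R)}(v))^2g_0''(v)-2\alpha^{(R)}(v)\beta^{(R)}(v)g_1'(v)}{(\alpha^{(R)}(v))^2},$$ where $g_0$ and $g_1$ denote the functions on $[0,1]$ given by the common values of the two sides of the first and of the second equation, respectively. -/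

import Mathlib

open Set Polynomial

noncomputable section

namespace TwoPatch

/-- The labels `L` and `R` of the two patches. -/
inductive Side
  | L
  | R

/-- The parameter interval `[0,1]`. -/
def unitI : Set ℝ := Icc 0 1

/-- The parameter square `[0,1]²`; points are written `(u, v)`. -/
def unitSq : Set (ℝ × ℝ) := unitI ×ˢ unitI

/-! ### Derivatives on `[0,1]` and `[0,1]²` (one-sided at the boundary) -/

section Derivatives

variable {E : Type*} [NormedAddCommGroup E] [NormedSpace ℝ E]

/-- Derivative of a function on `[0,1]`, one-sided at the end points. -/
def dI (f : ℝ → E) (t : ℝ) : E := derivWithin f unitI t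

/-- Partial derivative `D_u` of a function on `[0,1]²`. -/
def dU (G : ℝ × ℝ → E) (x : ℝ × ℝ) : E := dI (fun s => G (s, x.2)) x.1

/-- Partial derivative `D_v` of a function on `[0,1]²`. -/
def dV (G : ℝ × ℝ → E) (x : ℝ × ℝ) : E := dI (fun t => G (x.1, t)) x.2

end Derivatives

/-! ### Spline spaces -/

/-- `τ₁ < … < τ_k` are inner knots: they all lie strictly between `0` and `1`. -/
def IsInnerKnots {k : ℕ} (τ : Fin k → ℝ) : Prop :=
  StrictMono τ ∧ ∀ i, τ i ∈ Ioo (0 : ℝ) 1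

/-- The break points `0, τ₁, …, τ_k, 1`. -/
def breakPoint {k : ℕ} (τ : Fin k → ℝ) : Fin (k + 2) → ℝ :=
  Fin.cons 0 (Fin.snoc τ 1)

/-- The univariate spline space of degree `p` on `[0,1]` for the open knot vector with inner knots
`τ₁, …, τ_k`, each of multiplicity `p - r`: the functions that are a polynomial of degree at most
`p` on every knot span and are `r` times continuously differentiable on `[0,1]`. Membership
depends only on the values on `[0,1]`. -/
def splineSpace (p r : ℕ) {k : ℕ} (τ : Fin k → ℝ) : Set (ℝ → ℝ) :=
  {f | ContDiffOn ℝ r f unitI ∧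
    ∀ i : Fin (k + 1), ∃ P : ℝ[X], P.natDegree ≤ p ∧
      ∀ x ∈ Icc (breakPoint τ i.castSucc) (breakPoint τ i.succ), f x = P.eval x}

/-- The tensor-product spline space of bidegree `(p, p)` on `[0,1]²`: finite sums of products
`a(u) b(v)` of univariate splines. Membership depends only on the values on `[0,1]²`. -/
def splineSpace₂ (p r : ℕ) {k : ℕ} (τ : Fin k → ℝ) : Set (ℝ × ℝ → ℝ) :=
  {g | ∃ (n : ℕ) (a b : Fin n → ℝ → ℝ),
    (∀ i, a i ∈ splineSpace p r τ) ∧ (∀ i, b i ∈ splineSpace p r τ) ∧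
      ∀ u ∈ unitI, ∀ v ∈ unitI, g (u, v) = ∑ i, a i u * b i v}

/-! ### Two-patch parameterizations -/

/-- `det[a, b]` for `a, b ∈ ℝ²`. -/
def det₂ (a b : ℝ × ℝ) : ℝ := a.1 * b.2 - a.2 * b.1

/-- The patch `Ω^(S) = F^(S)([0,1]²)`. -/
def patch (F : Side → ℝ × ℝ → ℝ × ℝ) (S : Side) : Set (ℝ × ℝ) := F S '' unitSq

/-- The two-patch domain `Ω = Ω^(L) ∪ Ω^(R)`. -/
def domain (F : Side → ℝ × ℝ → ℝ × ℝ) : Set (ℝ × ℝ) := patch F Side.L ∪ patch F Side.R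

/-- The parameterization `F₀(v) = F^(L)(0, v)` of the interface. -/
def interfaceCurve (F : Side → ℝ × ℝ → ℝ × ℝ) (v : ℝ) : ℝ × ℝ := F Side.L (0, v)

/-- `F` consists of two regular geometry mappings with spline coordinates, each of them bijective
onto its patch, and the two patches meet exactly in the common edge `u = 0`. -/
structure IsTwoPatchParameterization (p r : ℕ) {k : ℕ} (τ : Fin k → ℝ)
    (F : Side → ℝ × ℝ → ℝ × ℝ) : Prop where
  spline_fst : ∀ S, (fun x => (F S x).1) ∈ splineSpace₂ p r τ
  spline_snd : ∀ S, (fun x => (F S x).2) ∈ splineSpace₂ p r τ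
  regular : ∀ S, ∀ x ∈ unitSq, det₂ (dU (F S) x) (dV (F S) x) ≠ 0
  injective : ∀ S, InjOn (F S) unitSq
  edge_eq : ∀ v ∈ unitI, F Side.L (0, v) = F Side.R (0, v)
  inter_eq : patch F Side.L ∩ patch F Side.R = interfaceCurve F '' unitI

/-! ### Isogeometric functions -/

/-- The space `𝒱` of isogeometric functions `φ : Ω → ℝ`: the function `φ ∘ F^(S)` is a
tensor-product spline for both `S`. A function on `Ω` is given as a function on `ℝ²` of which only
the values on `Ω` matter. -/
def isogeometricSpace (p r : ℕ) {k : ℕ} (τ : Fin k → ℝ) (F : Side → ℝ × ℝ → ℝ × ℝ) :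
    Set (ℝ × ℝ → ℝ) :=
  {φ | ∀ S, φ ∘ F S ∈ splineSpace₂ p r τ}

/-- The space `𝒱^s = 𝒱 ∩ C^s(Ω)` of globally `C^s`-smooth isogeometric functions. -/
def smoothIsogeometricSpace (p r : ℕ) {k : ℕ} (τ : Fin k → ℝ) (F : Side → ℝ × ℝ → ℝ × ℝ)
    (s : ℕ) : Set (ℝ × ℝ → ℝ) :=
  isogeometricSpace p r τ F ∩ {φ | ContDiffOn ℝ s φ (domain F)}

/-! ### Bilinear-like `G²` parameterizations -/

/-- `β = α^(L) β^(R) - α^(R) β^(L)`. -/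
def gluingBeta (α β : Side → ℝ[X]) (v : ℝ) : ℝ :=
  (α Side.L).eval v * (β Side.R).eval v - (α Side.R).eval v * (β Side.L).eval v

/-- `Z = (α^(L))² D_uu F^(R) - ((α^(R))² D_uu F^(L) + 2 α^(R) β D_uv F^(L) + β² F₀'')` on the
interface. -/
def gluingZ (F : Side → ℝ × ℝ → ℝ × ℝ) (α β : Side → ℝ[X]) (v : ℝ) : ℝ × ℝ :=
  ((α Side.L).eval v) ^ 2 • dU (dU (F Side.R)) (0, v)
    - (((α Side.R).eval v) ^ 2 • dU (dU (F Side.L)) (0, v)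
      + (2 * (α Side.R).eval v * gluingBeta α β v) • dV (dU (F Side.L)) (0, v)
      + (gluingBeta α β v) ^ 2 • dI (dI (interfaceCurve F)) v)

/-- `η = 2 (α^(L))' α^(R) β`. -/
def gluingEta (α β : Side → ℝ[X]) (v : ℝ) : ℝ :=
  2 * (derivative (α Side.L)).eval v * (α Side.R).eval v * gluingBeta α β v

/-- `θ = 2 (α^(L) (β^(L))' - (α^(L))' β^(L)) α^(R) β`. -/
def gluingTheta (α β : Side → ℝ[X]) (v : ℝ) : ℝ :=
  2 * ((α Side.L).eval v * (derivative (β Side.L)).eval v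
    - (derivative (α Side.L)).eval v * (β Side.L).eval v)
    * (α Side.R).eval v * gluingBeta α β v

/-- The two-patch parameterization `F` is bilinear-like `G²` with the functions
`α^(L), α^(R), β^(L), β^(R)`, which are polynomials of degree at most `1`. The sign condition
excludes trivial choices such as `α^(L) = α^(R) = 0`. -/
structure IsBilinearLikeG2With (F : Side → ℝ × ℝ → ℝ × ℝ) (α β : Side → ℝ[X]) : Prop where
  natDegree_alpha : ∀ S, (α S).natDegree ≤ 1
  natDegree_beta : ∀ S, (β S).natDegree ≤ 1
  alpha_mul_neg : ∀ v ∈ unitI, (α Side.L).eval v * (α Side.R).eval v < 0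
  edge_eq : ∀ v ∈ unitI, F Side.L (0, v) = F Side.R (0, v)
  first_order : ∀ v ∈ unitI,
    (α Side.R).eval v • dU (F Side.L) (0, v) - (α Side.L).eval v • dU (F Side.R) (0, v)
      + gluingBeta α β v • dV (F Side.L) (0, v) = 0
  second_order : ∀ v ∈ unitI,
    (α Side.L).eval v • gluingZ F α β v + gluingEta α β v • dU (F Side.L) (0, v)
      + gluingTheta α β v • dV (F Side.L) (0, v) = 0

/-! ### Interface quantities of an isogeometric function

Each is computed from one side `S`, for `g^(S) = φ ∘ F^(S)`; where the values from the two sides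
agree on `[0,1]`, so do the derivatives that enter the next quantity. -/

/-- `g₀(v) = g^(S)(0, v)`. -/
def gZero (F : Side → ℝ × ℝ → ℝ × ℝ) (φ : ℝ × ℝ → ℝ) (S : Side) (v : ℝ) : ℝ :=
  (φ ∘ F S) (0, v)

/-- `g₁(v) = (D_u g^(S)(0, v) - β^(S)(v) g₀'(v)) / α^(S)(v)`. -/
def gOne (F : Side → ℝ × ℝ → ℝ × ℝ) (α β : Side → ℝ[X]) (φ : ℝ × ℝ → ℝ) (S : Side) (v : ℝ) : ℝ :=
  (dU (φ ∘ F S) (0, v) - (β S).eval v * dI (gZero F φ S) v) / (α S).eval v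

/-- `g₂(v) = (D_uu g^(S)(0, v) - (β^(S)(v))² g₀''(v) - 2 α^(S)(v) β^(S)(v) g₁'(v)) / (α^(S)(v))²`. -/
def gTwo (F : Side → ℝ × ℝ → ℝ × ℝ) (α β : Side → ℝ[X]) (φ : ℝ × ℝ → ℝ) (S : Side) (v : ℝ) : ℝ :=
  (dU (dU (φ ∘ F S)) (0, v) - ((β S).eval v) ^ 2 * dI (dI (gZero F φ S)) v
    - 2 * (α S).eval v * (β S).eval v * dI (gOne F α β φ S) v) / ((α S).eval v) ^ 2

end TwoPatch

end

open TwoPatch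

/-! On each patch `φ` is `C^2`, because the inverse of a regular injective `C^2` map of the compact
square is `C^2`. Hence `φ` is `C^2` on the domain exactly when its gradient and Hessian from the two
sides agree on the interface (`contDiffOn_domain_iff`).

For one patch with gluing data `a`, `b`, put `V = F₀'`, `w = (D_u F - b V) / a` (`edgeOne`) and `z =
(D_uu F - b² F₀'' - 2 a b w') / a²` (`edgeTwo`). By the chain rule `g₁ = ∇φ(w)` and `g₂ = Hess φ(w,
w) + ∇φ(z)` (`edgeOne_comp`, `edgeTwo_comp`). The two gluing equations force `w` and `z` to be the
same from both sides (`edgeOne_eq`, `edgeTwo_eq`), so smoothness gives the equalities of `g₁` and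
`g₂`.

Conversely, `w` and `V` form a basis of the plane. The gradients agree on `V` because `φ` is
single-valued on the interface, and on `w` by the `g₁` equation. Differentiating this along the
interface, the Hessians agree once one argument is `V`; the `g₂` equation settles the pair `(w, w)`.
-/

open Filter Topology

/-! ### Inverses of regular maps on compact sets -/

section InverseOnCompact

variable {E G : Type*} [NormedAddCommGroup E] [NormedSpace ℝ E]
  [NormedAddCommGroup G] [NormedSpace ℝ G]

/-- The inverse of a continuous injection of a compact set is continuous on the image. -/
theorem continuousOn_invFunOn_image {X Y : Type*} [TopologicalSpace X] [Nonempty X]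
    [TopologicalSpace Y] [T2Space Y] {f : X → Y} {s : Set X} (hs : IsCompact s)
    (hf : ContinuousOn f s) (hinj : InjOn f s) :
    ContinuousOn (Function.invFunOn f s) (f '' s) := by
  rw [continuousOn_iff_isClosed]
  intro t ht
  -- The preimage of `t` under the inverse is the image of the compact set `s ∩ t`, hence closed.
  refine ⟨f '' (s ∩ t), ?_, ?_⟩
  · exact ((hs.inter_right ht).image_of_continuousOn (hf.mono inter_subset_left)).isClosed
  · ext y
    constructor
    · rintro ⟨hy, x, hx, rfl⟩
      refine ⟨⟨x, ⟨hx, ?_⟩, rfl⟩, mem_image_of_mem f hx⟩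
      simpa [hinj.leftInvOn_invFunOn hx] using hy
    · rintro ⟨⟨x, ⟨hx, hxt⟩, rfl⟩, hy⟩
      exact ⟨by simpa [hinj.leftInvOn_invFunOn hx] using hxt, hy⟩

theorem mapsTo_invFunOn_image {X Y : Type*} [Nonempty X] (f : X → Y) (s : Set X) :
    MapsTo (Function.invFunOn f s) (f '' s) s :=
  fun _ hy => Function.invFunOn_mem hy

theorem hasFDerivWithinAt_invFunOn_image {f : E → G} {s : Set E} (hs : IsCompact s)
    (hf : ContinuousOn f s) (hinj : InjOn f s) {f' : E →L[ℝ] G} {y : G} (hy : y ∈ f '' s)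
    (hf' : HasFDerivWithinAt f f' s (Function.invFunOn f s y)) (hinv : f'.IsInvertible) :
    HasFDerivWithinAt (Function.invFunOn f s) f'.inverse (f '' s) y := by
  obtain ⟨e, rfl⟩ := hinv
  rw [ContinuousLinearMap.inverse_equiv]
  refine HasFDerivWithinAt.of_local_left_inverse ?_ hf' hy ?_
  · exact tendsto_nhdsWithin_iff.2 ⟨continuousOn_invFunOn_image hs hf hinj y hy,
      eventually_mem_nhdsWithin.mono fun z hz => mapsTo_invFunOn_image f s hz⟩
  · exact eventually_mem_nhdsWithin.mono fun z hz => Function.invFunOn_eq hz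

/-- An invertible derivative has dense range, so it carries tangent directions with dense span to
tangent directions with dense span. -/
theorem uniqueDiffOn_image_of_isInvertible {f : E → G} {s : Set E} (hs : UniqueDiffOn ℝ s)
    (hf : DifferentiableOn ℝ f s) (hinv : ∀ x ∈ s, (fderivWithin ℝ f s x).IsInvertible) :
    UniqueDiffOn ℝ (f '' s) := by
  refine hs.image (fun x hx => (hf x hx).hasFDerivWithinAt) fun x hx => ?_
  obtain ⟨e, he⟩ := hinv x hx
  rw [← he]
  exact e.surjective.denseRange

/-- The inverse of a `C^n` immersion of a compact set onto its image is `C^n`. -/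
theorem contDiffOn_invFunOn_image [CompleteSpace E] {f : E → G} {s : Set E} (hs : IsCompact s)
    (hu : UniqueDiffOn ℝ s) (hinj : InjOn f s)
    (hinv : ∀ x ∈ s, (fderivWithin ℝ f s x).IsInvertible) {n : ℕ} (hn : n ≠ 0)
    (hf : ContDiffOn ℝ n f s) :
    ContDiffOn ℝ n (Function.invFunOn f s) (f '' s) := by
  have hd : DifferentiableOn ℝ f s := hf.differentiableOn (by exact_mod_cast hn)
  have hdinv : ∀ y ∈ f '' s, HasFDerivWithinAt (Function.invFunOn f s)
      (fderivWithin ℝ f s (Function.invFunOn f s y)).inverse (f '' s) y := fun y hy =>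
    hasFDerivWithinAt_invFunOn_image hs hf.continuousOn hinj hy
      (hd _ (mapsTo_invFunOn_image f s hy)).hasFDerivWithinAt
      (hinv _ (mapsTo_invFunOn_image f s hy))
  have hu' := uniqueDiffOn_image_of_isInvertible hu hd hinv
  have key : ∀ m : ℕ, m ≤ n → ContDiffOn ℝ m (Function.invFunOn f s) (f '' s) := by
    intro m
    -- Bootstrapping: the derivative of the inverse is operator inversion applied to `f'` composed
    -- with the inverse itself, so `C^m` regularity of the inverse yields `C^(m+1)`.
    induction m with
    | zero =>
      intro _
      exact contDiffOn_zero.2 (continuousOn_invFunOn_image hs hf.continuousOn hinj)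
    | succ m ih =>
      intro hm
      have h0 := ih (by omega)
      push_cast
      refine contDiffOn_succ_of_fderivWithin (fun y hy => (hdinv y hy).differentiableWithinAt)
        (fun h => by simp at h) ?_
      have h1 : ContDiffOn ℝ m (fderivWithin ℝ f s) s :=
        hf.fderivWithin hu (by exact_mod_cast hm)
      have h2 : ContDiffOn ℝ m (fun y => fderivWithin ℝ f s (Function.invFunOn f s y)) (f '' s) :=
        h1.comp h0 (mapsTo_invFunOn_image f s)
      refine ContDiffOn.congr (f := fun y =>
        (fderivWithin ℝ f s (Function.invFunOn f s y)).inverse) ?_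
        fun y hy => (hdinv y hy).fderivWithin (hu' y hy)
      intro y hy
      exact ((hinv _ (mapsTo_invFunOn_image f s hy)).contDiffAt_map_inverse).comp_contDiffWithinAt y
        (h2 y hy)
  exact key n le_rfl

theorem contDiffOn_image_of_comp [CompleteSpace E] {H : Type*} [NormedAddCommGroup H]
    [NormedSpace ℝ H] {f : E → G} {φ : G → H} {s : Set E}
    (hs : IsCompact s) (hu : UniqueDiffOn ℝ s) (hinj : InjOn f s)
    (hinv : ∀ x ∈ s, (fderivWithin ℝ f s x).IsInvertible) {n : ℕ} (hn : n ≠ 0)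
    (hf : ContDiffOn ℝ n f s) (hφ : ContDiffOn ℝ n (φ ∘ f) s) :
    ContDiffOn ℝ n φ (f '' s) := by
  refine (hφ.comp (contDiffOn_invFunOn_image hs hu hinj hinv hn hf)
    (mapsTo_invFunOn_image f s)).congr fun y hy => ?_
  simp [Function.invFunOn_eq hy]

/-- A `C^1` map with invertible derivatives maps the closure of the interior into the closure of
the interior of the image. -/
theorem mem_closure_interior_image [CompleteSpace E] {f : E → G} {s : Set E}
    (hinv : ∀ x ∈ s, (fderivWithin ℝ f s x).IsInvertible) (hf : ContDiffOn ℝ 1 f s)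
    {x : E} (hx : x ∈ s) (hxs : x ∈ closure (interior s)) :
    f x ∈ closure (interior (f '' s)) := by
  -- At interior points the strict derivative is invertible, so `f` is locally open there.
  have hsub : f '' interior s ⊆ interior (f '' s) := by
    rintro _ ⟨z, hz, rfl⟩
    have hzs : s ∈ 𝓝 z := mem_interior_iff_mem_nhds.1 hz
    obtain ⟨e, he⟩ := hinv z (interior_subset hz)
    have h1 : HasStrictFDerivAt f (e : E →L[ℝ] G) z := by
      have := ((hf z (interior_subset hz)).contDiffAt hzs).hasStrictFDerivAt one_ne_zero
      rwa [← fderivWithin_of_mem_nhds hzs, ← he] at this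
    rw [mem_interior_iff_mem_nhds, ← h1.map_nhds_eq_of_equiv]
    exact image_mem_map hzs
  exact closure_mono hsub (((hf.continuousOn x hx).mono interior_subset).mem_closure_image hxs)

end InverseOnCompact

/-! ### Gluing `C^2` functions along closed sets -/

section Gluing

variable {E G : Type*} [NormedAddCommGroup E] [NormedSpace ℝ E]
  [NormedAddCommGroup G] [NormedSpace ℝ G]

theorem UniqueDiffOn.union_of_uniqueDiffOn {s t : Set E} (hs : UniqueDiffOn ℝ s)
    (ht : UniqueDiffOn ℝ t) : UniqueDiffOn ℝ (s ∪ t) := by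
  rintro x (hx | hx)
  · exact (hs x hx).mono subset_union_left
  · exact (ht x hx).mono subset_union_right

theorem DifferentiableOn.hasFDerivWithinAt_union {f : E → G} {s t : Set E} (hs : IsClosed s)
    (ht : IsClosed t) (hfs : DifferentiableOn ℝ f s) (hft : DifferentiableOn ℝ f t)
    (h : EqOn (fderivWithin ℝ f s) (fderivWithin ℝ f t) (s ∩ t)) :
    (∀ x ∈ s, HasFDerivWithinAt f (fderivWithin ℝ f s x) (s ∪ t) x) ∧
      ∀ x ∈ t, HasFDerivWithinAt f (fderivWithin ℝ f t x) (s ∪ t) x := by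
  constructor <;> intro x hx
  · refine (hfs x hx).hasFDerivWithinAt.union ?_
    by_cases hxt : x ∈ t
    · rw [h ⟨hx, hxt⟩]
      exact (hft x hxt).hasFDerivWithinAt
    -- Off the closed set `t`, differentiability within `t` is vacuous, with any derivative.
    · exact .of_notMem_closure (by rwa [ht.closure_eq])
  · refine HasFDerivWithinAt.union ?_ (hft x hx).hasFDerivWithinAt
    by_cases hxs : x ∈ s
    · rw [← h ⟨hxs, hx⟩]
      exact (hfs x hxs).hasFDerivWithinAt
    · exact .of_notMem_closure (by rwa [hs.closure_eq])

/-- A function that is `C^2` on two closed sets is `C^2` on their union as soon as its first and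
second derivatives agree on the intersection. -/
theorem ContDiffOn.union_of_isClosed_two {f : E → G} {s t : Set E} (hs : IsClosed s)
    (ht : IsClosed t) (hus : UniqueDiffOn ℝ s) (hut : UniqueDiffOn ℝ t)
    (hfs : ContDiffOn ℝ 2 f s) (hft : ContDiffOn ℝ 2 f t)
    (h1 : EqOn (fderivWithin ℝ f s) (fderivWithin ℝ f t) (s ∩ t))
    (h2 : EqOn (fderivWithin ℝ (fderivWithin ℝ f s) s) (fderivWithin ℝ (fderivWithin ℝ f t) t)
      (s ∩ t)) :
    ContDiffOn ℝ 2 f (s ∪ t) := by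
  have hu := hus.union_of_uniqueDiffOn hut
  obtain ⟨hs1, ht1⟩ := DifferentiableOn.hasFDerivWithinAt_union hs ht
    (hfs.differentiableOn two_ne_zero) (hft.differentiableOn two_ne_zero) h1
  have es1 : EqOn (fderivWithin ℝ f (s ∪ t)) (fderivWithin ℝ f s) s :=
    fun x hx => (hs1 x hx).fderivWithin (hu x (Or.inl hx))
  have et1 : EqOn (fderivWithin ℝ f (s ∪ t)) (fderivWithin ℝ f t) t :=
    fun x hx => (ht1 x hx).fderivWithin (hu x (Or.inr hx))
  set D := fderivWithin ℝ f (s ∪ t) with hD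
  have hDs : ContDiffOn ℝ 1 D s := (hfs.fderivWithin hus (by norm_num)).congr es1
  have hDt : ContDiffOn ℝ 1 D t := (hft.fderivWithin hut (by norm_num)).congr et1
  have es2 : EqOn (fderivWithin ℝ D s) (fderivWithin ℝ (fderivWithin ℝ f s) s) s :=
    fun x hx => fderivWithin_congr es1 (es1 hx)
  have et2 : EqOn (fderivWithin ℝ D t) (fderivWithin ℝ (fderivWithin ℝ f t) t) t :=
    fun x hx => fderivWithin_congr et1 (et1 hx)
  obtain ⟨hs2, ht2⟩ := DifferentiableOn.hasFDerivWithinAt_union hs ht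
    (hDs.differentiableOn one_ne_zero) (hDt.differentiableOn one_ne_zero)
    (fun x hx => by rw [es2 hx.1, et2 hx.2, h2 hx])
  have e3s : EqOn (fderivWithin ℝ D (s ∪ t)) (fderivWithin ℝ D s) s :=
    fun x hx => (hs2 x hx).fderivWithin (hu x (Or.inl hx))
  have e3t : EqOn (fderivWithin ℝ D (s ∪ t)) (fderivWithin ℝ D t) t :=
    fun x hx => (ht2 x hx).fderivWithin (hu x (Or.inr hx))
  have hcont : ContinuousOn (fderivWithin ℝ D (s ∪ t)) (s ∪ t) :=
    ContinuousOn.union_of_isClosed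
      ((hDs.continuousOn_fderivWithin hus le_rfl).congr e3s)
      ((hDt.continuousOn_fderivWithin hut le_rfl).congr e3t) hs ht
  have hD1 : ContDiffOn ℝ (0 + 1) D (s ∪ t) := by
    refine contDiffOn_succ_of_fderivWithin ?_ (fun h => by simp at h) (contDiffOn_zero.2 hcont)
    rintro x (hx | hx)
    exacts [(hs2 x hx).differentiableWithinAt, (ht2 x hx).differentiableWithinAt]
  have : ContDiffOn ℝ (1 + 1) f (s ∪ t) := by
    refine contDiffOn_succ_of_fderivWithin ?_ (fun h => by simp at h) (by simpa using hD1)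
    rintro x (hx | hx)
    exacts [(hs1 x hx).differentiableWithinAt, (ht1 x hx).differentiableWithinAt]
  simpa [one_add_one_eq_two] using this

end Gluing

namespace TwoPatch

theorem uniqueDiffOn_unitI : UniqueDiffOn ℝ unitI := uniqueDiffOn_Icc zero_lt_one

theorem zero_mem_unitI : (0 : ℝ) ∈ unitI := ⟨le_rfl, zero_le_one⟩

theorem zero_mk_mem_unitSq {v : ℝ} (hv : v ∈ unitI) : ((0 : ℝ), v) ∈ unitSq :=
  ⟨zero_mem_unitI, hv⟩

theorem isCompact_unitSq : IsCompact unitSq := isCompact_Icc.prod isCompact_Icc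

theorem uniqueDiffOn_unitSq : UniqueDiffOn ℝ unitSq :=
  uniqueDiffOn_unitI.prod uniqueDiffOn_unitI

theorem mem_closure_interior_unitSq {x : ℝ × ℝ} (hx : x ∈ unitSq) :
    x ∈ closure (interior unitSq) := by
  have h : closure (interior unitI) = unitI := by
    rw [unitI, interior_Icc, closure_Ioo zero_ne_one]
  rw [unitSq, interior_prod_eq, closure_prod_eq, h]
  exact hx

/-! ### Slice derivatives on the square -/

section Calculus

variable {E : Type*} [NormedAddCommGroup E] [NormedSpace ℝ E]

theorem dI_congr {f g : ℝ → E} (h : EqOn f g unitI) {t : ℝ} (ht : t ∈ unitI) :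
    dI f t = dI g t :=
  derivWithin_congr h (h ht)

theorem _root_.HasDerivWithinAt.dI_eq {f : ℝ → E} {f' : E} {t : ℝ}
    (h : HasDerivWithinAt f f' unitI t) (ht : t ∈ unitI) : dI f t = f' :=
  h.derivWithin (uniqueDiffOn_unitI t ht)

theorem contDiffOn_dI {f : ℝ → E} {m n : ℕ∞} (hf : ContDiffOn ℝ n f unitI) (hmn : m + 1 ≤ n) :
    ContDiffOn ℝ m (dI f) unitI :=
  hf.derivWithin uniqueDiffOn_unitI (by exact_mod_cast hmn)

theorem hasDerivWithinAt_dI {f : ℝ → E} (hf : ContDiffOn ℝ 1 f unitI) {t : ℝ} (ht : t ∈ unitI) :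
    HasDerivWithinAt f (dI f t) unitI t :=
  (hf.differentiableOn one_ne_zero t ht).hasDerivWithinAt

variable {f : ℝ × ℝ → E}

theorem hasDerivWithinAt_fst_slice (hf : DifferentiableOn ℝ f unitSq) {u v : ℝ} (hu : u ∈ unitI)
    (hv : v ∈ unitI) : HasDerivWithinAt (fun s => f (s, v))
      (fderivWithin ℝ f unitSq (u, v) (1, 0)) unitI u :=
  (hf (u, v) ⟨hu, hv⟩).hasFDerivWithinAt.comp_hasDerivWithinAt (f := fun s => (s, v)) u
    ((hasDerivWithinAt_id u _).prodMk (hasDerivWithinAt_const u _ v)) fun _ hs => ⟨hs, hv⟩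

theorem hasDerivWithinAt_snd_slice (hf : DifferentiableOn ℝ f unitSq) {u v : ℝ} (hu : u ∈ unitI)
    (hv : v ∈ unitI) : HasDerivWithinAt (fun t => f (u, t))
      (fderivWithin ℝ f unitSq (u, v) (0, 1)) unitI v :=
  (hf (u, v) ⟨hu, hv⟩).hasFDerivWithinAt.comp_hasDerivWithinAt (f := fun t => (u, t)) v
    ((hasDerivWithinAt_const v _ u).prodMk (hasDerivWithinAt_id v _)) fun _ ht => ⟨hu, ht⟩

theorem dU_eq_fderivWithin (hf : DifferentiableOn ℝ f unitSq) {x : ℝ × ℝ} (hx : x ∈ unitSq) :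
    dU f x = fderivWithin ℝ f unitSq x (1, 0) :=
  (hasDerivWithinAt_fst_slice hf hx.1 hx.2).dI_eq hx.1

theorem dV_eq_fderivWithin (hf : DifferentiableOn ℝ f unitSq) {x : ℝ × ℝ} (hx : x ∈ unitSq) :
    dV f x = fderivWithin ℝ f unitSq x (0, 1) :=
  (hasDerivWithinAt_snd_slice hf hx.1 hx.2).dI_eq hx.2

theorem hasDerivWithinAt_dU (hf : DifferentiableOn ℝ f unitSq) {u v : ℝ} (hu : u ∈ unitI)
    (hv : v ∈ unitI) : HasDerivWithinAt (fun s => f (s, v)) (dU f (u, v)) unitI u :=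
  (hasDerivWithinAt_fst_slice hf hu hv).differentiableWithinAt.hasDerivWithinAt

theorem hasDerivWithinAt_dV (hf : DifferentiableOn ℝ f unitSq) {u v : ℝ} (hu : u ∈ unitI)
    (hv : v ∈ unitI) : HasDerivWithinAt (fun t => f (u, t)) (dV f (u, v)) unitI v :=
  (hasDerivWithinAt_snd_slice hf hu hv).differentiableWithinAt.hasDerivWithinAt

theorem contDiffOn_dU (hf : ContDiffOn ℝ 2 f unitSq) : ContDiffOn ℝ 1 (dU f) unitSq :=
  ((hf.fderivWithin uniqueDiffOn_unitSq (by norm_num)).clm_apply contDiffOn_const).congr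
    fun _ hx => dU_eq_fderivWithin (hf.differentiableOn two_ne_zero) hx

theorem contDiffOn_edge {n : ℕ∞} (hf : ContDiffOn ℝ n f unitSq) :
    ContDiffOn ℝ n (fun v => f (0, v)) unitI :=
  hf.comp (contDiff_prodMk_right (0 : ℝ)).contDiffOn fun _ hv => zero_mk_mem_unitSq hv

end Calculus

section Splines

variable {p r k : ℕ} {τ : Fin k → ℝ}

theorem contDiffOn_of_mem_splineSpace₂ {g : ℝ × ℝ → ℝ} (hg : g ∈ splineSpace₂ p r τ) :
    ContDiffOn ℝ r g unitSq := by
  obtain ⟨n, a, b, ha, hb, h⟩ := hg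
  refine ContDiffOn.congr (f := fun x : ℝ × ℝ => ∑ i, a i x.1 * b i x.2) ?_
    fun x hx => h x.1 hx.1 x.2 hx.2
  refine ContDiffOn.sum fun i _ => ContDiffOn.mul ?_ ?_
  · exact (ha i).1.comp contDiffOn_fst fun x hx => hx.1
  · exact (hb i).1.comp contDiffOn_snd fun x hx => hx.2

end Splines

/-! ### Bases of the plane -/

section PlaneGeometry

theorem exists_eq_smul_add_smul {a b : ℝ × ℝ} (h : det₂ a b ≠ 0) (w : ℝ × ℝ) :
    ∃ c d : ℝ, w = c • a + d • b := by
  -- Cramer's rule.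
  refine ⟨det₂ w b / det₂ a b, det₂ a w / det₂ a b, ?_⟩
  ext <;> simp only [Prod.fst_add, Prod.snd_add, Prod.smul_fst, Prod.smul_snd, smul_eq_mul] <;>
    field_simp <;> simp only [det₂] <;> ring

theorem isInvertible_of_det₂_ne_zero {A : ℝ × ℝ →L[ℝ] ℝ × ℝ}
    (h : det₂ (A (1, 0)) (A (0, 1)) ≠ 0) : A.IsInvertible := by
  have hsurj : Function.Surjective A := fun w => by
    obtain ⟨c, d, rfl⟩ := exists_eq_smul_add_smul h w
    exact ⟨c • (1, 0) + d • (0, 1), by simp only [map_add, map_smul]⟩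
  have hinj : Function.Injective A :=
    (LinearMap.injective_iff_surjective (f := A.toLinearMap)).2 hsurj
  exact ⟨ContinuousLinearEquiv.ofBijective A (LinearMap.ker_eq_bot.2 hinj)
    (LinearMap.range_eq_top.2 hsurj), by ext <;> simp⟩

/-- The target `E` is left general so that this serves for gradients (`E = ℝ`) and for Hessians (`E`
the dual of the plane). -/
theorem clm_eq_of_apply_eq {E : Type*} [NormedAddCommGroup E] [NormedSpace ℝ E]
    {A B : ℝ × ℝ →L[ℝ] E} {a b : ℝ × ℝ} (h : det₂ a b ≠ 0) (ha : A a = B a) (hb : A b = B b) :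
    A = B := by
  refine ContinuousLinearMap.ext fun w => ?_
  obtain ⟨c, d, rfl⟩ := exists_eq_smul_add_smul h w
  simp only [map_add, map_smul, ha, hb]

end PlaneGeometry

/-! ### Transversal quantities on the edge -/

section EdgeJets

variable {E : Type*} [NormedAddCommGroup E] [NormedSpace ℝ E]

/-- The first-order transversal edge quantity `(D_u f - b f₀') / a` on the edge `u = 0`. -/
noncomputable def edgeOne (f : ℝ × ℝ → E) (a b : ℝ[X]) (v : ℝ) : E :=
  (a.eval v)⁻¹ • (dU f (0, v) - b.eval v • dI (fun t => f (0, t)) v)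

/-- The second-order transversal edge quantity `(D_uu f - b² f₀'' - 2 a b f₁') / a²` on the edge
`u = 0`, where `f₁ = edgeOne f a b`. -/
noncomputable def edgeTwo (f : ℝ × ℝ → E) (a b : ℝ[X]) (v : ℝ) : E :=
  ((a.eval v) ^ 2)⁻¹ • (dU (dU f) (0, v) - (b.eval v) ^ 2 • dI (dI fun t => f (0, t)) v
    - (2 * a.eval v * b.eval v) • dI (edgeOne f a b) v)

variable {f : ℝ × ℝ → E} {a b : ℝ[X]}

/-- The explicit quotient rule is needed for `edgeTwo_eq`: it brings in the mixed derivative of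
`gluingZ`, and `a'`, `b'` produce `gluingEta` and `gluingTheta`. -/
theorem hasDerivWithinAt_edgeOne (hf : ContDiffOn ℝ 2 f unitSq) {v : ℝ} (hv : v ∈ unitI)
    (ha : a.eval v ≠ 0) :
    HasDerivWithinAt (edgeOne f a b)
      ((a.eval v)⁻¹ • (dV (dU f) (0, v) - (b.eval v • dI (dI fun t => f (0, t)) v
          + (derivative b).eval v • dI (fun t => f (0, t)) v))
        + (-(derivative a).eval v / a.eval v ^ 2) •
          (dU f (0, v) - b.eval v • dI (fun t => f (0, t)) v)) unitI v := by
  have h1 := hasDerivWithinAt_dV ((contDiffOn_dU hf).differentiableOn one_ne_zero)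
    zero_mem_unitI hv
  have h2 := hasDerivWithinAt_dI (contDiffOn_dI (m := 1) (n := 2)
    (contDiffOn_edge (n := 2) hf) (by norm_num)) hv
  exact ((a.hasDerivAt v).hasDerivWithinAt.inv ha).smul
    (h1.sub ((b.hasDerivAt v).hasDerivWithinAt.smul h2))

theorem dU_eq_edgeOne {v : ℝ} (ha : a.eval v ≠ 0) :
    dU f (0, v) = a.eval v • edgeOne f a b v + b.eval v • dI (fun t => f (0, t)) v := by
  rw [edgeOne, smul_inv_smul₀ ha, sub_add_cancel]

end EdgeJets

/-! ### Chain rule for the edge quantities -/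

section ChainRule

variable {f : ℝ × ℝ → ℝ × ℝ} {φ : ℝ × ℝ → ℝ} {P : Set (ℝ × ℝ)} {a b : ℝ[X]}

theorem dU_comp (hf : DifferentiableOn ℝ f unitSq) (hP : MapsTo f unitSq P)
    (hφ : DifferentiableOn ℝ φ P) {x : ℝ × ℝ} (hx : x ∈ unitSq) :
    dU (φ ∘ f) x = fderivWithin ℝ φ P (f x) (dU f x) :=
  ((hφ (f x) (hP hx)).hasFDerivWithinAt.comp_hasDerivWithinAt (f := fun s => f (s, x.2)) x.1
    (hasDerivWithinAt_dU hf hx.1 hx.2) fun _ hs => hP ⟨hs, hx.2⟩).dI_eq hx.1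

theorem dI_edge_comp (hf : DifferentiableOn ℝ f unitSq) (hP : MapsTo f unitSq P)
    (hφ : DifferentiableOn ℝ φ P) {v : ℝ} (hv : v ∈ unitI) :
    dI (fun t => (φ ∘ f) (0, t)) v
      = fderivWithin ℝ φ P (f (0, v)) (dI (fun t => f (0, t)) v) :=
  ((hφ _ (hP (zero_mk_mem_unitSq hv))).hasFDerivWithinAt.comp_hasDerivWithinAt
    (f := fun t => f (0, t)) v
    (hasDerivWithinAt_dV hf zero_mem_unitI hv) fun _ ht => hP (zero_mk_mem_unitSq ht)).dI_eq hv

theorem edgeOne_comp (hf : DifferentiableOn ℝ f unitSq) (hP : MapsTo f unitSq P)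
    (hφ : DifferentiableOn ℝ φ P) {v : ℝ} (hv : v ∈ unitI) :
    edgeOne (φ ∘ f) a b v = fderivWithin ℝ φ P (f (0, v)) (edgeOne f a b v) := by
  rw [edgeOne, edgeOne, dU_comp hf hP hφ (zero_mk_mem_unitSq hv), dI_edge_comp hf hP hφ hv,
    map_smul, map_sub, map_smul]

/-- Differentiation of the gradient of `φ` along a curve, applied to a vector field. -/
theorem hasDerivWithinAt_fderivWithin_apply {c w : ℝ → ℝ × ℝ} {c' w' : ℝ × ℝ} {t : ℝ}
    (hφ : DifferentiableOn ℝ (fderivWithin ℝ φ P) P) (hcP : MapsTo c unitI P) (ht : t ∈ unitI)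
    (hc : HasDerivWithinAt c c' unitI t) (hw : HasDerivWithinAt w w' unitI t) :
    HasDerivWithinAt (fun s => fderivWithin ℝ φ P (c s) (w s))
      (fderivWithin ℝ (fderivWithin ℝ φ P) P (c t) c' (w t) + fderivWithin ℝ φ P (c t) w')
      unitI t :=
  ((hφ _ (hcP ht)).hasFDerivWithinAt.comp_hasDerivWithinAt t hc hcP).clm_apply hw

/-- Expand `D_u f = a w + b V` in `Hess φ(D_u f, D_u f)`. Subtracting `b² g₀''` removes the `(V, V)`
term and `2 a b g₁'` removes the mixed ones, leaving `a² Hess φ(w, w)`; the gradient terms assemble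
to `a² ∇φ(edgeTwo f)`. -/
theorem edgeTwo_comp (hf : ContDiffOn ℝ 2 f unitSq) (hP : MapsTo f unitSq P)
    (hφ : DifferentiableOn ℝ φ P) (hφ' : DifferentiableOn ℝ (fderivWithin ℝ φ P) P)
    (ha : ∀ v ∈ unitI, a.eval v ≠ 0) {v : ℝ} (hv : v ∈ unitI)
    (hsymm : IsSymmSndFDerivWithinAt ℝ φ P (f (0, v))) :
    edgeTwo (φ ∘ f) a b v
      = fderivWithin ℝ (fderivWithin ℝ φ P) P (f (0, v)) (edgeOne f a b v) (edgeOne f a b v)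
        + fderivWithin ℝ φ P (f (0, v)) (edgeTwo f a b v) := by
  have hfd := hf.differentiableOn two_ne_zero
  have hedge : MapsTo (fun t => f (0, t)) unitI P := fun t ht => hP (zero_mk_mem_unitSq ht)
  have hc := hasDerivWithinAt_dI (contDiffOn_edge (n := 1) (hf.of_le one_le_two)) hv
  have hc' := hasDerivWithinAt_dI (contDiffOn_dI (m := 1) (n := 2)
    (contDiffOn_edge (n := 2) hf) (by norm_num)) hv
  have e2 : dI (dI fun t => (φ ∘ f) (0, t)) v = _ :=
    (dI_congr (fun t ht => dI_edge_comp hfd hP hφ ht) hv).trans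
      ((hasDerivWithinAt_fderivWithin_apply hφ' hedge hv hc hc').dI_eq hv)
  have hw : HasDerivWithinAt (edgeOne f a b) (dI (edgeOne f a b) v) unitI v :=
    (hasDerivWithinAt_edgeOne hf hv (ha v hv)).differentiableWithinAt.hasDerivWithinAt
  have e1 : dI (edgeOne (φ ∘ f) a b) v = _ :=
    (dI_congr (fun t ht => edgeOne_comp hfd hP hφ ht) hv).trans
      ((hasDerivWithinAt_fderivWithin_apply hφ' hedge hv hc hw).dI_eq hv)
  have e0 : dU (dU (φ ∘ f)) (0, v) = _ :=
    (dI_congr (fun s hs => dU_comp hfd hP hφ (x := (s, v)) ⟨hs, hv⟩) zero_mem_unitI).trans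
      ((hasDerivWithinAt_fderivWithin_apply hφ' (c := fun s => f (s, v))
        (fun s hs => hP ⟨hs, hv⟩) zero_mem_unitI
        (hasDerivWithinAt_dU hfd zero_mem_unitI hv)
        (hasDerivWithinAt_dU ((contDiffOn_dU hf).differentiableOn one_ne_zero)
          zero_mem_unitI hv)).dI_eq zero_mem_unitI)
  have hav := ha v hv
  rw [edgeTwo, edgeTwo, e0, e1, e2, dU_eq_edgeOne (f := f) (b := b) hav]
  simp only [map_add, map_sub, map_smul, add_apply, smul_apply, smul_eq_mul]
  -- The expansion contains both `Hess φ(w, V)` and `Hess φ(V, w)`, while `g₁'` supplies only the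
  -- latter.
  rw [hsymm (edgeOne f a b v) (dI (fun t => f (0, t)) v)]
  field_simp
  ring

end ChainRule


/-! ### The two sides of the interface -/

section TwoPatches

variable {p r k : ℕ} {τ : Fin k → ℝ} {F : Side → ℝ × ℝ → ℝ × ℝ} {α β : Side → ℝ[X]}
  {φ : ℝ × ℝ → ℝ}

theorem gOne_eq_edgeOne (S : Side) : gOne F α β φ S = edgeOne (φ ∘ F S) (α S) (β S) := by
  ext v
  simp only [gOne, edgeOne, smul_eq_mul, div_eq_inv_mul]
  rfl

theorem gTwo_eq_edgeTwo (S : Side) : gTwo F α β φ S = edgeTwo (φ ∘ F S) (α S) (β S) := by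
  ext v
  simp only [gTwo, edgeTwo, smul_eq_mul, div_eq_inv_mul, gOne_eq_edgeOne]
  rfl

namespace IsBilinearLikeG2With

variable (h : IsBilinearLikeG2With F α β)
include h

theorem eval_alpha_ne_zero (S : Side) {v : ℝ} (hv : v ∈ unitI) : (α S).eval v ≠ 0 := by
  have := (h.alpha_mul_neg v hv).ne
  cases S
  exacts [left_ne_zero_of_mul this, right_ne_zero_of_mul this]

theorem dI_edge_eq {v : ℝ} (hv : v ∈ unitI) :
    dI (fun t => F Side.R (0, t)) v = dI (fun t => F Side.L (0, t)) v :=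
  dI_congr (fun t ht => (h.edge_eq t ht).symm) hv

/-- Multiplied by `α^(L) α^(R)`, the difference of the sides is the left side of `first_order`. -/
theorem edgeOne_eq {v : ℝ} (hv : v ∈ unitI) :
    edgeOne (F Side.L) (α Side.L) (β Side.L) v = edgeOne (F Side.R) (α Side.R) (β Side.R) v := by
  have h1 := h.first_order v hv
  have hL := h.eval_alpha_ne_zero Side.L hv
  have hR := h.eval_alpha_ne_zero Side.R hv
  rw [edgeOne, edgeOne, h.dI_edge_eq hv]
  change _ + _ • dI (fun t => F Side.L (0, t)) v = 0 at h1
  generalize dI (fun t => F Side.L (0, t)) v = V at *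
  have h11 := congrArg Prod.fst h1
  have h12 := congrArg Prod.snd h1
  simp only [gluingBeta, Prod.fst_add, Prod.fst_sub, Prod.smul_fst, Prod.snd_add, Prod.snd_sub,
    Prod.smul_snd, smul_eq_mul, Prod.fst_zero, Prod.snd_zero] at h11 h12
  ext <;> simp only [Prod.fst_sub, Prod.smul_fst, Prod.snd_sub, Prod.smul_snd, smul_eq_mul] <;>
    field_simp
  · linear_combination h11
  · linear_combination h12

/-- With the common `w'` computed from the left patch, the difference of the sides times `(α^(L))³
(α^(R))²` is minus the left side of `second_order`. -/
theorem edgeTwo_eq (hF : ContDiffOn ℝ 2 (F Side.L) unitSq) {v : ℝ} (hv : v ∈ unitI) :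
    edgeTwo (F Side.L) (α Side.L) (β Side.L) v = edgeTwo (F Side.R) (α Side.R) (β Side.R) v := by
  have h2 := h.second_order v hv
  have hL := h.eval_alpha_ne_zero Side.L hv
  have hR := h.eval_alpha_ne_zero Side.R hv
  have e1 : dI (edgeOne (F Side.R) (α Side.R) (β Side.R)) v
      = dI (edgeOne (F Side.L) (α Side.L) (β Side.L)) v :=
    dI_congr (fun t ht => (h.edgeOne_eq ht).symm) hv
  have e2 : dI (dI fun t => F Side.R (0, t)) v = dI (dI fun t => F Side.L (0, t)) v :=
    dI_congr (fun t ht => h.dI_edge_eq ht) hv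
  rw [edgeTwo, edgeTwo, e1, e2, (hasDerivWithinAt_edgeOne hF hv hL).dI_eq hv]
  change _ + _ • dI (fun t => F Side.L (0, t)) v = 0 at h2
  change _ • (_ - (_ + _ + _ • dI (dI fun t => F Side.L (0, t)) v)) + _ + _ = _ at h2
  generalize dI (fun t => F Side.L (0, t)) v = V at *
  generalize dI (dI fun t => F Side.L (0, t)) v = W at *
  have h21 := congrArg Prod.fst h2
  have h22 := congrArg Prod.snd h2
  simp only [gluingBeta, gluingEta, gluingTheta, Prod.fst_add, Prod.fst_sub, Prod.smul_fst,
    Prod.snd_add, Prod.snd_sub, Prod.smul_snd, smul_eq_mul, Prod.fst_zero, Prod.snd_zero]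
    at h21 h22
  ext <;> simp only [Prod.fst_add, Prod.fst_sub, Prod.smul_fst, Prod.snd_add, Prod.snd_sub,
    Prod.smul_snd, smul_eq_mul] <;> field_simp
  · linear_combination -h21
  · linear_combination -h22

end IsBilinearLikeG2With

namespace IsTwoPatchParameterization

variable (h : IsTwoPatchParameterization p r τ F)
include h

theorem contDiffOn (hr : 2 ≤ r) (S : Side) : ContDiffOn ℝ 2 (F S) unitSq :=
  ((contDiffOn_of_mem_splineSpace₂ (h.spline_fst S)).prodMk
    (contDiffOn_of_mem_splineSpace₂ (h.spline_snd S))).of_le (by exact_mod_cast hr)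

theorem isInvertible_fderivWithin (hr : 2 ≤ r) (S : Side) {x : ℝ × ℝ} (hx : x ∈ unitSq) :
    (fderivWithin ℝ (F S) unitSq x).IsInvertible := by
  have hd := (h.contDiffOn hr S).differentiableOn two_ne_zero
  refine isInvertible_of_det₂_ne_zero ?_
  rw [← dU_eq_fderivWithin hd hx, ← dV_eq_fderivWithin hd hx]
  exact h.regular S x hx

theorem isClosed_patch (hr : 2 ≤ r) (S : Side) : IsClosed (patch F S) :=
  (isCompact_unitSq.image_of_continuousOn (h.contDiffOn hr S).continuousOn).isClosed

theorem uniqueDiffOn_patch (hr : 2 ≤ r) (S : Side) : UniqueDiffOn ℝ (patch F S) :=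
  uniqueDiffOn_image_of_isInvertible uniqueDiffOn_unitSq
    ((h.contDiffOn hr S).differentiableOn two_ne_zero)
    fun _ hx => h.isInvertible_fderivWithin hr S hx

theorem contDiffOn_patch (hr : 2 ≤ r) (hφ : φ ∈ isogeometricSpace p r τ F) (S : Side) :
    ContDiffOn ℝ 2 φ (patch F S) :=
  contDiffOn_image_of_comp (n := 2) isCompact_unitSq uniqueDiffOn_unitSq (h.injective S)
    (fun _ hx => h.isInvertible_fderivWithin hr S hx) two_ne_zero (h.contDiffOn hr S)
    ((contDiffOn_of_mem_splineSpace₂ (hφ S)).of_le (by exact_mod_cast hr))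

/-- Symmetry is needed at boundary points of the patch; it holds there because they are limits of
interior points. -/
theorem isSymmSndFDerivWithinAt (hr : 2 ≤ r) (hφ : φ ∈ isogeometricSpace p r τ F) (S : Side)
    {x : ℝ × ℝ} (hx : x ∈ unitSq) : IsSymmSndFDerivWithinAt ℝ φ (patch F S) (F S x) :=
  (h.contDiffOn_patch hr hφ S _ (mem_image_of_mem _ hx)).isSymmSndFDerivWithinAt (by simp)
    (h.uniqueDiffOn_patch hr S)
    (mem_closure_interior_image (fun _ hx => h.isInvertible_fderivWithin hr S hx)
      ((h.contDiffOn hr S).of_le one_le_two) hx (mem_closure_interior_unitSq hx))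
    (mem_image_of_mem _ hx)

/-- Since `D_u F = a w + b V`, the Jacobian determinant equals `a det[w, V]`. -/
theorem det₂_edgeOne_ne_zero {v : ℝ} (hv : v ∈ unitI) (S : Side) {a b : ℝ[X]}
    (ha : a.eval v ≠ 0) :
    det₂ (edgeOne (F S) a b v) (dI (fun t => F S (0, t)) v) ≠ 0 := by
  have hdet := h.regular S (0, v) (zero_mk_mem_unitSq hv)
  change det₂ _ (dI (fun t => F S (0, t)) v) ≠ 0 at hdet
  rw [dU_eq_edgeOne (b := b) ha] at hdet
  contrapose! hdet
  simp only [det₂, Prod.fst_add, Prod.smul_fst, Prod.snd_add, Prod.smul_snd, smul_eq_mul]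
    at hdet ⊢
  linear_combination a.eval v * hdet

/-- An isogeometric function is `C^2` if and only if the first and second derivatives from the two
sides agree on the interface. -/
theorem contDiffOn_domain_iff (hr : 2 ≤ r) (hφ : φ ∈ isogeometricSpace p r τ F) :
    ContDiffOn ℝ 2 φ (domain F) ↔
      EqOn (fderivWithin ℝ φ (patch F Side.L)) (fderivWithin ℝ φ (patch F Side.R))
        (patch F Side.L ∩ patch F Side.R) ∧
      EqOn (fderivWithin ℝ (fderivWithin ℝ φ (patch F Side.L)) (patch F Side.L))
        (fderivWithin ℝ (fderivWithin ℝ φ (patch F Side.R)) (patch F Side.R))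
        (patch F Side.L ∩ patch F Side.R) := by
  have huL := h.uniqueDiffOn_patch hr Side.L
  have huR := h.uniqueDiffOn_patch hr Side.R
  refine ⟨fun hC => ?_, fun ⟨h1, h2⟩ => ContDiffOn.union_of_isClosed_two
    (h.isClosed_patch hr _) (h.isClosed_patch hr _) huL huR
    (h.contDiffOn_patch hr hφ _) (h.contDiffOn_patch hr hφ _) h1 h2⟩
  have hd := hC.differentiableOn two_ne_zero
  have hd' : DifferentiableOn ℝ (fderivWithin ℝ φ (domain F)) (domain F) :=
    (hC.fderivWithin (m := 1) (huL.union_of_uniqueDiffOn huR) (by norm_num)).differentiableOn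
      one_ne_zero
  -- Derivatives within the domain restrict to any subset with unique derivatives, so both patches
  -- inherit the same ones.
  have key : ∀ P, P ⊆ domain F → UniqueDiffOn ℝ P →
      EqOn (fderivWithin ℝ φ P) (fderivWithin ℝ φ (domain F)) P ∧
      EqOn (fderivWithin ℝ (fderivWithin ℝ φ P) P)
        (fderivWithin ℝ (fderivWithin ℝ φ (domain F)) (domain F)) P := by
    intro P hP hu
    have e1 : EqOn (fderivWithin ℝ φ P) (fderivWithin ℝ φ (domain F)) P :=
      fun y hy => fderivWithin_subset hP (hu y hy) (hd y (hP hy))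
    exact ⟨e1, fun y hy => (fderivWithin_congr e1 (e1 hy)).trans
      (fderivWithin_subset hP (hu y hy) (hd' y (hP hy)))⟩
  obtain ⟨l1, l2⟩ := key _ subset_union_left huL
  obtain ⟨r1, r2⟩ := key _ subset_union_right huR
  exact ⟨fun y hy => (l1 hy.1).trans (r1 hy.2).symm, fun y hy => (l2 hy.1).trans (r2 hy.2).symm⟩

end IsTwoPatchParameterization

end TwoPatches

end TwoPatch

/-! ### The equivalence -/

open TwoPatch
theorem lemma1 (p r k : ℕ) (hp : 5 ≤ p) (hr : 2 ≤ r) (hrp : r ≤ p - 3)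
    (τ : Fin k → ℝ) (hτ : IsInnerKnots τ)
    (F : Side → ℝ × ℝ → ℝ × ℝ) (hF : IsTwoPatchParameterization p r τ F)
    (α β : Side → Polynomial ℝ) (hαβ : IsBilinearLikeG2With F α β)
    (φ : ℝ × ℝ → ℝ) (hφ : φ ∈ isogeometricSpace p r τ F) :
    φ ∈ smoothIsogeometricSpace p r τ F 2 ↔
      (∀ v ∈ unitI, gZero F φ Side.L v = gZero F φ Side.R v) ∧
      (∀ v ∈ unitI, gOne F α β φ Side.L v = gOne F α β φ Side.R v) ∧
      (∀ v ∈ unitI, gTwo F α β φ Side.L v = gTwo F α β φ Side.R v) := by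
  have hFd : ∀ S, DifferentiableOn ℝ (F S) unitSq := fun S =>
    (hF.contDiffOn hr S).differentiableOn two_ne_zero
  have hP : ∀ S, MapsTo (F S) unitSq (patch F S) := fun S => mapsTo_image _ _
  have hφC := hF.contDiffOn_patch hr hφ
  have hφd : ∀ S, DifferentiableOn ℝ φ (patch F S) := fun S =>
    (hφC S).differentiableOn two_ne_zero
  have hφd' : ∀ S, DifferentiableOn ℝ (fderivWithin ℝ φ (patch F S)) (patch F S) := fun S =>
    ((hφC S).fderivWithin (m := 1) (hF.uniqueDiffOn_patch hr S) (by norm_num)).differentiableOn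
      one_ne_zero
  have g1 : ∀ S, ∀ v ∈ unitI, gOne F α β φ S v =
      fderivWithin ℝ φ (patch F S) (F S (0, v)) (edgeOne (F S) (α S) (β S) v) := fun S v hv => by
    rw [gOne_eq_edgeOne, edgeOne_comp (hFd S) (hP S) (hφd S) hv]
  have g2 : ∀ S, ∀ v ∈ unitI, gTwo F α β φ S v = _ := fun S v hv => by
    rw [gTwo_eq_edgeTwo, edgeTwo_comp (hF.contDiffOn hr S) (hP S) (hφd S) (hφd' S)
      (fun v hv => hαβ.eval_alpha_ne_zero S hv) hv
      (hF.isSymmSndFDerivWithinAt hr hφ S (zero_mk_mem_unitSq hv))]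
  have hmem : φ ∈ smoothIsogeometricSpace p r τ F 2 ↔ ContDiffOn ℝ 2 φ (domain F) :=
    ⟨fun h => h.2, fun h => ⟨hφ, h⟩⟩
  rw [hmem, hF.contDiffOn_domain_iff hr hφ, hF.inter_eq]
  refine ⟨fun ⟨h1, h2⟩ => ⟨fun v hv => congrArg φ (hF.edge_eq v hv), fun v hv => ?_,
    fun v hv => ?_⟩, fun ⟨_, h1, h2⟩ => ?_⟩
  · have e1 : fderivWithin ℝ φ _ (F Side.L (0, v)) = _ := h1 (mem_image_of_mem _ hv)
    rw [g1 _ v hv, g1 _ v hv, e1, hαβ.edgeOne_eq hv, ← hF.edge_eq v hv]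
  · have e1 : fderivWithin ℝ φ _ (F Side.L (0, v)) = fderivWithin ℝ φ _ (F Side.L (0, v)) :=
      h1 (mem_image_of_mem _ hv)
    have e2 : fderivWithin ℝ (fderivWithin ℝ φ _) _ (F Side.L (0, v))
      = fderivWithin ℝ (fderivWithin ℝ φ _) _ (F Side.L (0, v)) := h2 (mem_image_of_mem _ hv)
    rw [g2 _ v hv, g2 _ v hv, e1, e2, hαβ.edgeOne_eq hv,
      hαβ.edgeTwo_eq (hF.contDiffOn hr _) hv, ← hF.edge_eq v hv]
  · have hdet : ∀ v ∈ unitI, det₂ (edgeOne (F Side.L) (α Side.L) (β Side.L) v)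
        (dI (fun t => F Side.L (0, t)) v) ≠ 0 := fun v hv =>
      hF.det₂_edgeOne_ne_zero hv Side.L (hαβ.eval_alpha_ne_zero _ hv)
    have d1 : ∀ v ∈ unitI, fderivWithin ℝ φ (patch F Side.L) (F Side.L (0, v))
        = fderivWithin ℝ φ (patch F Side.R) (F Side.R (0, v)) := by
      intro v hv
      refine clm_eq_of_apply_eq (hdet v hv) ?_ ?_
      · rw [← g1 _ v hv, h1 v hv, g1 _ v hv, hαβ.edgeOne_eq hv]
      -- Both tangential derivatives are `g₀'`, and `g₀` is side-independent because the two edge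
      -- maps coincide.
      · rw [← dI_edge_comp (hFd _) (hP _) (hφd _) hv, ← hαβ.dI_edge_eq hv,
          ← dI_edge_comp (hFd _) (hP _) (hφd _) hv]
        exact dI_congr (fun t ht => congrArg φ (hF.edge_eq t ht)) hv
    have along : ∀ S, ∀ v ∈ unitI,
        HasDerivWithinAt (fun t => fderivWithin ℝ φ (patch F S) (F S (0, t)))
          (fderivWithin ℝ (fderivWithin ℝ φ (patch F S)) (patch F S) (F S (0, v))
            (dI (fun t => F S (0, t)) v)) unitI v := fun S v hv =>
      (hφd' S _ (hP S (zero_mk_mem_unitSq hv))).hasFDerivWithinAt.comp_hasDerivWithinAt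
        (f := fun t => F S (0, t)) v (hasDerivWithinAt_dV (hFd S) zero_mem_unitI hv)
        fun _ ht => hP S (zero_mk_mem_unitSq ht)
    -- Differentiate the identity `d1` of gradients along the interface.
    have d2V : ∀ v ∈ unitI,
        fderivWithin ℝ (fderivWithin ℝ φ (patch F Side.L)) (patch F Side.L) (F Side.L (0, v))
            (dI (fun t => F Side.L (0, t)) v)
          = fderivWithin ℝ (fderivWithin ℝ φ (patch F Side.R)) (patch F Side.R) (F Side.R (0, v))
            (dI (fun t => F Side.L (0, t)) v) := by
      intro v hv
      have hR := (along Side.R v hv).dI_eq hv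
      rw [hαβ.dI_edge_eq hv] at hR
      rw [← hR, ← (along Side.L v hv).dI_eq hv]
      exact dI_congr d1 hv
    have d2 : ∀ v ∈ unitI,
        fderivWithin ℝ (fderivWithin ℝ φ (patch F Side.L)) (patch F Side.L) (F Side.L (0, v))
          = fderivWithin ℝ (fderivWithin ℝ φ (patch F Side.R)) (patch F Side.R)
            (F Side.R (0, v)) := by
      intro v hv
      have hx := zero_mk_mem_unitSq hv
      -- Compare on the basis `w`, `V` in each argument: `(w, w)` comes from `g₂` after cancelling
      -- `∇φ(z)`, and `(w, V)` from `d2V` by symmetry.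
      refine clm_eq_of_apply_eq (hdet v hv) (clm_eq_of_apply_eq (hdet v hv) ?_ ?_) (d2V v hv)
      · have := h2 v hv
        rw [g2 _ v hv, g2 _ v hv, ← hαβ.edgeOne_eq hv,
          ← hαβ.edgeTwo_eq (hF.contDiffOn hr _) hv, d1 v hv] at this
        exact add_right_cancel this
      · rw [hF.isSymmSndFDerivWithinAt hr hφ Side.L hx, d2V v hv,
          hF.isSymmSndFDerivWithinAt hr hφ Side.R hx]
    constructor
    · rintro _ ⟨v, hv, rfl⟩
      exact (d1 v hv).trans (by rw [← hF.edge_eq v hv]; rfl)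
    · rintro _ ⟨v, hv, rfl⟩
      exact (d2 v hv).trans (by rw [← hF.edge_eq v hv]; rfl)
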